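/- Let $G$ be a (real, finite-dimensional) Lie group with Lie algebra $\mathfrak g=T_eG$, let $M$ and $P$ be Hausdorff finite-dimensional $C^\infty$ manifolds, and let $\pi:P\to M$ be a smooth principal $G$-bundle: $\pi$ is smooth, $G$ acts smoothly on $P$ on the right, the action preserves the fibres of $\pi$ and is free and transitive on each of them, and every point of $M$ has an open neighbourhood $U$ with a diffeomorphism $\pi^{-1}(U)\to U\times G$, $p\mapsto(\pi(p),s(p))$, such that $s(pg)=s(p)g$. Write $R_g(p)=pg$, $V_p=\ker(d\pi_p)\subset T_pP$, $\mathrm{Ad}_g=d(h\mapsto ghg^{-1})_e$, and for $A\in\mathfrak g$ let $A^*$ be the fundamental vector field $A^*_p=\frac{d}{dt}\big|_{t=0}\,p\exp(tA)$. Consider: (1) families $H=(H_p)_{p\in P}$ of subspaces $H_p\subset T_pP$ such that $T_pP=V_p\oplus H_p$ for all $p$, which are smooth (locally spanned by $\dim M$ smooth, linearly independent vector fields on $P$), and such that $(R_g)_*(H_p)=H_{pg}$ for all $p\in P$, $g\in G$; (2) smooth $\mathfrak g$-valued $1$-forms $\omega$ on $P$ such that $\omega_p(A^*_p)=A$ for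 all $A\in\mathfrak g$, $p\in P$, and $\omega_{pg}\big((R_g)_*X\big)=\mathrm{Ad}_{g^{-1}}\,\omega_p(X)$ for all $p\in P$, $g\in G$, $X\in T_pP$. Then the two definitions (1) and (2) of a connection on $P$ are equivalent: the map $\omega\mapsto H$, $H_p=\ker\omega_p$, is a bijection from the set of forms in (2) onto the set of distributions in (1). -/

import Mathlib

open scoped Manifold ContDiff

namespace PrincipalConnection

noncomputable section

section LieGroup

variable (EG : Type*) [NormedAddCommGroup EG] [NormedSpace ℝ EG]
  {G : Type*} [TopologicalSpace G] [ChartedSpace EG G] [Group G]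

/-- The derivative of `t ↦ g * γ t`, for `γ` an integral curve of a left-invariant field. -/
lemma isMIntegralCurveOn_mul_left [LieGroup 𝓘(ℝ, EG) ∞ G] (A : GroupLieAlgebra 𝓘(ℝ, EG) G)
    {γ : ℝ → G} {s : Set ℝ} (g : G)
    (h : IsMIntegralCurveOn (I := 𝓘(ℝ, EG)) γ (mulInvariantVectorField A) s) :
    IsMIntegralCurveOn (I := 𝓘(ℝ, EG)) (fun t => g * γ t) (mulInvariantVectorField A) s := by
  intro t ht
  have hsm : ∀ a : G, ContMDiff 𝓘(ℝ, EG) 𝓘(ℝ, EG) ∞ (fun x : G => a * x) :=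
    fun a => contMDiff_mul_left
  have hd : ∀ a b : G, MDifferentiableAt 𝓘(ℝ, EG) 𝓘(ℝ, EG) (fun x : G => a * x) b :=
    fun a b => (hsm a).mdifferentiableAt (by simp)
  have h1 := (hd g (γ t)).hasMFDerivAt.comp_hasMFDerivWithinAt t (h t ht)
  have key : mfderiv 𝓘(ℝ, EG) 𝓘(ℝ, EG) (fun x : G => g * x) (γ t) (mulInvariantVectorField A (γ t))
      = mulInvariantVectorField A (g * γ t) := by
    have e : (fun x : G => g * γ t * x) = (fun x : G => g * x) ∘ (fun x : G => γ t * x) := by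
      funext x; simp [mul_assoc]
    have hc := mfderiv_comp_of_eq (I := 𝓘(ℝ, EG)) (I' := 𝓘(ℝ, EG)) (I'' := 𝓘(ℝ, EG))
      (x := (1 : G)) (f := fun x : G => γ t * x) (g := fun x : G => g * x) (y := γ t)
      (hd g (γ t)) (hd (γ t) 1) (mul_one _)
    unfold mulInvariantVectorField
    rw [e, hc, mul_one]
    rfl
  rw [← key]
  have e2 : (mfderiv 𝓘(ℝ, EG) 𝓘(ℝ, EG) (fun x : G => g * x) (γ t)).comp
      ((1 : ℝ →L[ℝ] ℝ).smulRight (mulInvariantVectorField A (γ t))) =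
      (1 : ℝ →L[ℝ] ℝ).smulRight
        (mfderiv 𝓘(ℝ, EG) 𝓘(ℝ, EG) (fun x : G => g * x) (γ t) (mulInvariantVectorField A (γ t))) :=
    ContinuousLinearMap.ext fun r => by
      simp only [ContinuousLinearMap.comp_apply, ContinuousLinearMap.smulRight_apply, map_smul]
  exact e2 ▸ h1

/-- Left-invariant vector fields on a Lie group are complete. -/
lemma exists_oneParameter [FiniteDimensional ℝ EG] [T2Space G] [LieGroup 𝓘(ℝ, EG) ∞ G]
    (A : GroupLieAlgebra 𝓘(ℝ, EG) G) :
    ∃ γ : ℝ → G, γ 0 = 1 ∧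
      IsMIntegralCurve (I := 𝓘(ℝ, EG)) γ (mulInvariantVectorField A) := by
  have : CompleteSpace EG := FiniteDimensional.complete ℝ EG
  have : LieGroup 𝓘(ℝ, EG) (minSmoothness ℝ 3) G :=
    LieGroup.of_le (n := ∞) (by
      rw [minSmoothness_of_isRCLikeNormedField]; exact ENat.LEInfty.out)
  have : IsManifold 𝓘(ℝ, EG) 1 G := inferInstance
  have hv : ContMDiff 𝓘(ℝ, EG) 𝓘(ℝ, EG).tangent 1
      (fun g : G => (⟨g, mulInvariantVectorField A g⟩ : TangentBundle 𝓘(ℝ, EG) G)) :=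
    (contMDiff_mulInvariantVectorField A).of_le
      (by rw [minSmoothness_of_isRCLikeNormedField]; exact mod_cast one_le_two)
  obtain ⟨γ, h0, hγ⟩ := exists_isMIntegralCurveAt_of_contMDiffAt_boundaryless (t₀ := 0)
    (hv.contMDiffAt (x := (1 : G)))
  obtain ⟨ε, hε, hγ⟩ := isMIntegralCurveAt_iff'.1 hγ
  rw [Real.ball_eq_Ioo, zero_sub, zero_add] at hγ
  exact exists_isMIntegralCurve_of_isMIntegralCurveOn hv hε
    (fun g => ⟨fun t => g * γ t, by simp [h0], isMIntegralCurveOn_mul_left EG A g hγ⟩) 1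

variable [FiniteDimensional ℝ EG] [T2Space G] [LieGroup 𝓘(ℝ, EG) ∞ G]

/-- The exponential map `𝔤 → G`: `lieExp A = γ 1`, where `γ` is the integral curve, starting at the
identity, of the left-invariant vector field generated by `A`. -/
def lieExp (A : GroupLieAlgebra 𝓘(ℝ, EG) G) : G :=
  (exists_oneParameter EG A).choose 1

end LieGroup

/-- The adjoint representation: `Ad g` is the differential at the identity of `h ↦ g * h * g⁻¹`. -/
def Ad (EG : Type*) [NormedAddCommGroup EG] [NormedSpace ℝ EG]
    {G : Type*} [TopologicalSpace G] [ChartedSpace EG G] [Group G] (g : G) :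
    GroupLieAlgebra 𝓘(ℝ, EG) G →L[ℝ] GroupLieAlgebra 𝓘(ℝ, EG) G :=
  mfderiv 𝓘(ℝ, EG) 𝓘(ℝ, EG) (fun h : G => g * h * g⁻¹) 1

section Bundle

variable (EM EG EP : Type*) [NormedAddCommGroup EM] [NormedSpace ℝ EM]
  [NormedAddCommGroup EG] [NormedSpace ℝ EG] [NormedAddCommGroup EP] [NormedSpace ℝ EP]
  {M G P : Type*} [TopologicalSpace M] [ChartedSpace EM M]
  [TopologicalSpace G] [ChartedSpace EG G] [Group G]
  [TopologicalSpace P] [ChartedSpace EP P]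

/-- The right translation `R_g : p ↦ p · g`; a right action of `G` is an action of `Gᵐᵒᵖ`. -/
def rightTranslation [MulAction Gᵐᵒᵖ P] (g : G) (p : P) : P := MulOpposite.op g • p

variable (G) in
/-- `π : P → M` is a smooth principal `G`-bundle. -/
structure IsPrincipalBundle [MulAction Gᵐᵒᵖ P] (π : P → M) : Prop where
  contMDiff_proj : ContMDiff 𝓘(ℝ, EP) 𝓘(ℝ, EM) ∞ π
  contMDiff_action : ContMDiff (𝓘(ℝ, EP).prod 𝓘(ℝ, EG)) 𝓘(ℝ, EP) ∞
    (fun x : P × G => rightTranslation x.2 x.1)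
  proj_rightTranslation : ∀ (g : G) (p : P), π (rightTranslation g p) = π p
  free : ∀ (g : G) (p : P), rightTranslation g p = p → g = 1
  transitive : ∀ p q : P, π p = π q → ∃ g : G, rightTranslation g p = q
  /-- Around each point of the base there is an equivariant diffeomorphism
  `T = (π, s) : π⁻¹(U) → U × G`. -/
  locally_trivial : ∀ x : M, ∃ (U : Set M) (T : OpenPartialHomeomorph P (M × G)),
    IsOpen U ∧ x ∈ U ∧ T.source = π ⁻¹' U ∧ T.target = U ×ˢ Set.univ ∧
    ContMDiffOn 𝓘(ℝ, EP) (𝓘(ℝ, EM).prod 𝓘(ℝ, EG)) ∞ T T.source ∧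
    ContMDiffOn (𝓘(ℝ, EM).prod 𝓘(ℝ, EG)) 𝓘(ℝ, EP) ∞ T.symm T.target ∧
    (∀ p ∈ T.source, (T p).1 = π p) ∧
    ∀ p ∈ T.source, ∀ g : G, (T (rightTranslation g p)).2 = (T p).2 * g

/-- The fundamental vector field of `A ∈ 𝔤`: the velocity at `t = 0` of `t ↦ p · exp (t A)`. -/
def fundamentalField [FiniteDimensional ℝ EG] [T2Space G] [LieGroup 𝓘(ℝ, EG) ∞ G]
    [MulAction Gᵐᵒᵖ P] (A : GroupLieAlgebra 𝓘(ℝ, EG) G) (p : P) : TangentSpace 𝓘(ℝ, EP) p :=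
  mfderiv 𝓘(ℝ, ℝ) 𝓘(ℝ, EP) (fun t : ℝ => rightTranslation (lieExp EG (t • A)) p) 0 (1 : ℝ)

/-- The vertical subspace `V_p = ker π_*`. -/
def vertical (π : P → M) (p : P) : Submodule ℝ (TangentSpace 𝓘(ℝ, EP) p) :=
  LinearMap.ker (mfderiv 𝓘(ℝ, EP) 𝓘(ℝ, EM) π p).toLinearMap

/-- A smooth distribution of rank `k`: locally spanned by `k` smooth, linearly independent vector
fields. -/
def IsSmoothDistribution [IsManifold 𝓘(ℝ, EP) ∞ P] (k : ℕ)
    (H : (p : P) → Submodule ℝ (TangentSpace 𝓘(ℝ, EP) p)) : Prop :=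
  ∀ p : P, ∃ (U : Set P) (X : Fin k → (q : P) → TangentSpace 𝓘(ℝ, EP) q),
    IsOpen U ∧ p ∈ U ∧
    (∀ i, ContMDiffOn 𝓘(ℝ, EP) 𝓘(ℝ, EP).tangent ∞
      (fun q : P => (⟨q, X i q⟩ : TangentBundle 𝓘(ℝ, EP) P)) U) ∧
    ∀ q ∈ U, LinearIndependent ℝ (fun i => X i q) ∧
      Submodule.span ℝ (Set.range fun i => X i q) = H q

variable (G) in
/-- A connection as a horizontal distribution: a smooth distribution, of rank `dim M`,
complementary to the vertical one and invariant under right translations. -/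
structure IsHorizontalDistribution [IsManifold 𝓘(ℝ, EP) ∞ P] [MulAction Gᵐᵒᵖ P] (π : P → M)
    (H : (p : P) → Submodule ℝ (TangentSpace 𝓘(ℝ, EP) p)) : Prop where
  isCompl : ∀ p : P, IsCompl (vertical EM EP π p) (H p)
  smooth : IsSmoothDistribution EP (Module.finrank ℝ EM) H
  equivariant : ∀ (g : G) (p : P),
    (H p).map (mfderiv 𝓘(ℝ, EP) 𝓘(ℝ, EP) (rightTranslation g) p).toLinearMap =
      H (rightTranslation g p)

/-- A field of linear forms `θ_p : T_p P → 𝔤` is a smooth `𝔤`-valued 1-form if it is a smooth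
section of the bundle `Hom (TP, P × 𝔤)`. -/
def IsSmoothOneForm [IsManifold 𝓘(ℝ, EP) ∞ P]
    (θ : (p : P) → TangentSpace 𝓘(ℝ, EP) p →L[ℝ] GroupLieAlgebra 𝓘(ℝ, EG) G) : Prop :=
  ContMDiff 𝓘(ℝ, EP) (𝓘(ℝ, EP).prod 𝓘(ℝ, EP →L[ℝ] EG)) ∞
    (fun p : P => Bundle.TotalSpace.mk' (EP →L[ℝ] EG)
      (E := fun q : P => TangentSpace 𝓘(ℝ, EP) q →L[ℝ] Bundle.Trivial P EG q) p (θ p))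

/-- A connection as a connection form: a smooth `𝔤`-valued 1-form with `θ (A*) = A` and
`R_g^* θ = Ad_{g⁻¹} θ`. -/
structure IsConnectionForm [IsManifold 𝓘(ℝ, EP) ∞ P] [FiniteDimensional ℝ EG] [T2Space G]
    [LieGroup 𝓘(ℝ, EG) ∞ G] [MulAction Gᵐᵒᵖ P]
    (θ : (p : P) → TangentSpace 𝓘(ℝ, EP) p →L[ℝ] GroupLieAlgebra 𝓘(ℝ, EG) G) : Prop where
  smooth : IsSmoothOneForm EG EP θ
  fundamental : ∀ (A : GroupLieAlgebra 𝓘(ℝ, EG) G) (p : P), θ p (fundamentalField EG EP A p) = A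
  equivariant : ∀ (g : G) (p : P) (X : TangentSpace 𝓘(ℝ, EP) p),
    θ (rightTranslation g p) (mfderiv 𝓘(ℝ, EP) 𝓘(ℝ, EP) (rightTranslation g) p X) =
      Ad EG g⁻¹ (θ p X)

/-- The field of kernels `p ↦ ker θ_p`. -/
def kernelField (θ : (p : P) → TangentSpace 𝓘(ℝ, EP) p →L[ℝ] GroupLieAlgebra 𝓘(ℝ, EG) G) (p : P) :
    Submodule ℝ (TangentSpace 𝓘(ℝ, EP) p) :=
  LinearMap.ker (θ p).toLinearMap

end Bundle

end

end PrincipalConnection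

namespace PrincipalConnection

noncomputable section

/-! At each `p` the map `A ↦ A*_p` is the differential at `1` of the orbit map
(`fundamentalField_eq`), hence linear. A local trivialization splits `T_p P` as `T_{π p} M × 𝔤` with
this map as the inclusion of `𝔤` (`exists_tangentSplitting`), so it is an isomorphism of `𝔤` onto
the vertical space. A form with `θ (A*) = A` is therefore a left inverse of that inclusion, and such
left inverses correspond to complements of `V_p` through their kernels: `v - (θ v)*` is the
component of `v` in the kernel.

Equivariance matches on the two sides because `(R_g)_* A* = (Ad_{g⁻¹} A)*`. For smoothness, a local
frame of `ker θ` is obtained by subtracting vertical parts from arbitrary smooth fields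
(`isSmoothDistribution_kernelField`). Conversely, `θ` has constant values on the frame made of a
local frame of `H` and of fundamental fields, and smooth values on a smooth frame make a form smooth
(`contMDiffAt_oneForm_of_frame`). -/

lemma mulInvariantVectorField_apply_one {EG : Type*} [NormedAddCommGroup EG] [NormedSpace ℝ EG]
    {G : Type*} [TopologicalSpace G] [ChartedSpace EG G] [Group G]
    (A : GroupLieAlgebra 𝓘(ℝ, EG) G) :
    (mulInvariantVectorField A (1 : G) : EG) = A := by
  have e : (fun x : G => 1 * x) = id := by funext x; simp
  change mfderiv 𝓘(ℝ, EG) 𝓘(ℝ, EG) (fun x : G => 1 * x) 1 A = A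
  rw [e, mfderiv_id]
  rfl

/-- `t ↦ exp (t A)` is the integral curve of `A` through the identity. -/
lemma exists_isMIntegralCurve_lieExp_smul {EG : Type*} [NormedAddCommGroup EG] [NormedSpace ℝ EG]
    [FiniteDimensional ℝ EG] {G : Type*} [TopologicalSpace G] [T2Space G] [ChartedSpace EG G]
    [Group G] [LieGroup 𝓘(ℝ, EG) ∞ G] (A : GroupLieAlgebra 𝓘(ℝ, EG) G) :
    ∃ γ : ℝ → G, γ 0 = 1 ∧ IsMIntegralCurve (I := 𝓘(ℝ, EG)) γ (mulInvariantVectorField A) ∧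
      ∀ t : ℝ, lieExp EG (t • A) = γ t := by
  have : CompleteSpace EG := FiniteDimensional.complete ℝ EG
  have : LieGroup 𝓘(ℝ, EG) (minSmoothness ℝ 3) G :=
    LieGroup.of_le (n := ∞) (by
      rw [minSmoothness_of_isRCLikeNormedField]; exact ENat.LEInfty.out)
  have : IsManifold 𝓘(ℝ, EG) 1 G := inferInstance
  have hv (B : GroupLieAlgebra 𝓘(ℝ, EG) G) : ContMDiff 𝓘(ℝ, EG) 𝓘(ℝ, EG).tangent 1
      (fun g : G => (⟨g, mulInvariantVectorField B g⟩ : TangentBundle 𝓘(ℝ, EG) G)) :=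
    (contMDiff_mulInvariantVectorField B).of_le
      (by rw [minSmoothness_of_isRCLikeNormedField]; exact mod_cast one_le_two)
  obtain ⟨h0, hγ⟩ := (exists_oneParameter EG A).choose_spec
  refine ⟨_, h0, hγ, fun t => ?_⟩
  obtain ⟨h0', hγ'⟩ := (exists_oneParameter EG (t • A)).choose_spec
  -- Rescaling time by `t` turns an integral curve of `A` into one of `t • A`; uniqueness then
  -- identifies it with the curve defining `lieExp EG (t • A)`, and both are read at time `1`.
  have hc := hγ.comp_mul t
  rw [← mulInvariantVectorField_smul] at hc
  have h1 := congrFun (isMIntegralCurve_Ioo_eq_of_contMDiff_boundaryless (t₀ := 0) (hv (t • A))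
    hγ' hc (by simp [h0, h0'])) 1
  exact h1.trans (congrArg _ (one_mul t))

lemma rightTranslation_one {G P : Type*} [Group G] [MulAction Gᵐᵒᵖ P] (p : P) :
    rightTranslation (1 : G) p = p := by
  simp [rightTranslation]

lemma rightTranslation_rightTranslation {G P : Type*} [Group G] [MulAction Gᵐᵒᵖ P]
    (g h : G) (p : P) :
    rightTranslation h (rightTranslation g p) = rightTranslation (g * h) p := by
  simp [rightTranslation, mul_smul]

/-! ### The infinitesimal action and the splitting of the tangent space -/

section Bundle

variable {EM EG EP : Type*} [NormedAddCommGroup EM] [NormedSpace ℝ EM]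
  [NormedAddCommGroup EG] [NormedSpace ℝ EG] [NormedAddCommGroup EP] [NormedSpace ℝ EP]
  {M G P : Type*} [TopologicalSpace M] [ChartedSpace EM M]
  [TopologicalSpace G] [ChartedSpace EG G] [Group G]
  [TopologicalSpace P] [ChartedSpace EP P] [MulAction Gᵐᵒᵖ P]

variable (EG EP G) in
/-- The infinitesimal action `A ↦ A*_p`: the differential at `1` of the orbit map `g ↦ p · g`. -/
def infinitesimalAction (p : P) : GroupLieAlgebra 𝓘(ℝ, EG) G →L[ℝ] TangentSpace 𝓘(ℝ, EP) p :=
  mfderiv 𝓘(ℝ, EG) 𝓘(ℝ, EP) (fun g : G => rightTranslation g p) 1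

namespace IsPrincipalBundle

variable {π : P → M}

lemma mdifferentiableAt_orbit (hπ : IsPrincipalBundle EM EG EP G π) (p : P) (g : G) :
    MDifferentiableAt 𝓘(ℝ, EG) 𝓘(ℝ, EP) (fun g : G => rightTranslation g p) g :=
  (hπ.contMDiff_action.comp (contMDiff_const.prodMk contMDiff_id)).mdifferentiableAt
    (by simp)

lemma mdifferentiableAt_rightTranslation (hπ : IsPrincipalBundle EM EG EP G π) (g : G) (p : P) :
    MDifferentiableAt 𝓘(ℝ, EP) 𝓘(ℝ, EP) (rightTranslation g : P → P) p :=
  (hπ.contMDiff_action.comp (contMDiff_id.prodMk contMDiff_const)).mdifferentiableAt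
    (by simp)

lemma mdifferentiableAt_proj (hπ : IsPrincipalBundle EM EG EP G π) (p : P) :
    MDifferentiableAt 𝓘(ℝ, EP) 𝓘(ℝ, EM) π p :=
  hπ.contMDiff_proj.mdifferentiableAt (by simp)

/-- Chain rule along `t ↦ exp (t A)`, whose velocity at `0` is `A`. From here on the exponential map
can be forgotten and linearity in `A` is automatic. -/
lemma fundamentalField_eq [FiniteDimensional ℝ EG] [T2Space G] [LieGroup 𝓘(ℝ, EG) ∞ G]
    (hπ : IsPrincipalBundle EM EG EP G π) (A : GroupLieAlgebra 𝓘(ℝ, EG) G) (p : P) :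
    fundamentalField EG EP A p = infinitesimalAction EG EP G p A := by
  obtain ⟨γ, h0, hγ, hexp⟩ := exists_isMIntegralCurve_lieExp_smul A
  have e : (fun t : ℝ => rightTranslation (lieExp EG (t • A)) p) =
      (fun g : G => rightTranslation g p) ∘ γ := by
    funext t; simp [hexp]
  have hv : (mfderiv 𝓘(ℝ, ℝ) 𝓘(ℝ, EG) γ 0 (1 : ℝ) : EG) = A := by
    rw [(hγ 0).mfderiv]
    refine (one_smul ℝ (mulInvariantVectorField A (γ 0) : EG)).trans ?_
    rw [h0]
    exact mulInvariantVectorField_apply_one A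
  unfold fundamentalField
  rw [e]
  refine (mfderiv_comp_apply_of_eq 0 (hπ.mdifferentiableAt_orbit p 1) (hγ 0).mdifferentiableAt h0
    (1 : ℝ)).trans ?_
  exact congrArg (infinitesimalAction EG EP G p) hv

lemma proj_infinitesimalAction (hπ : IsPrincipalBundle EM EG EP G π) (p : P)
    (A : GroupLieAlgebra 𝓘(ℝ, EG) G) :
    mfderiv 𝓘(ℝ, EP) 𝓘(ℝ, EM) π p (infinitesimalAction EG EP G p A) = 0 := by
  have e : π ∘ (fun g : G => rightTranslation g p) = fun _ => π p := by
    funext g; exact hπ.proj_rightTranslation g p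
  have h := mfderiv_comp_apply_of_eq 1 (hπ.mdifferentiableAt_proj p)
    (hπ.mdifferentiableAt_orbit p 1) (rightTranslation_one p) A
  rw [e, mfderiv_const] at h
  exact h.symm

/-- `(R_g)_* A* = (Ad_{g⁻¹} A)*`. -/
lemma mfderiv_rightTranslation_infinitesimalAction [LieGroup 𝓘(ℝ, EG) ∞ G]
    (hπ : IsPrincipalBundle EM EG EP G π) (g : G) (p : P) (A : GroupLieAlgebra 𝓘(ℝ, EG) G) :
    mfderiv 𝓘(ℝ, EP) 𝓘(ℝ, EP) (rightTranslation g) p (infinitesimalAction EG EP G p A) =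
      infinitesimalAction EG EP G (rightTranslation g p) (Ad EG g⁻¹ A) := by
  -- The identity `(p h) g = (p g)(g⁻¹ h g)`, differentiated in `h` at `1`. The double inverse keeps
  -- the conjugation in the form that defines `Ad EG g⁻¹`.
  have e : (rightTranslation g : P → P) ∘ (fun h : G => rightTranslation h p) =
      (fun h : G => rightTranslation h (rightTranslation g p)) ∘
        (fun h : G => g⁻¹ * h * g⁻¹⁻¹) := by
    funext h
    simp [rightTranslation_rightTranslation, mul_assoc]
  have hc : MDifferentiableAt 𝓘(ℝ, EG) 𝓘(ℝ, EG) (fun h : G => g⁻¹ * h * g⁻¹⁻¹) 1 :=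
    ((contMDiff_mul_right (I := 𝓘(ℝ, EG)) (n := ∞) (a := g⁻¹⁻¹)).comp
      (contMDiff_mul_left (I := 𝓘(ℝ, EG)) (n := ∞) (a := g⁻¹))).mdifferentiableAt (by simp)
  have h1 := mfderiv_comp_apply_of_eq 1 (hπ.mdifferentiableAt_rightTranslation g p)
    (hπ.mdifferentiableAt_orbit p 1) (rightTranslation_one p) A
  have h2 := mfderiv_comp_apply_of_eq 1 (hπ.mdifferentiableAt_orbit (rightTranslation g p) 1)
    hc (by simp) A
  rw [e] at h1
  exact h1.symm.trans h2

lemma mfderiv_rightTranslation_inv (hπ : IsPrincipalBundle EM EG EP G π) {g : G} {p q : P}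
    (hq : rightTranslation g⁻¹ q = p) (v : TangentSpace 𝓘(ℝ, EP) q) :
    mfderiv 𝓘(ℝ, EP) 𝓘(ℝ, EP) (rightTranslation g) p
      (mfderiv 𝓘(ℝ, EP) 𝓘(ℝ, EP) (rightTranslation g⁻¹) q v) = v := by
  have e : (rightTranslation g : P → P) ∘ rightTranslation g⁻¹ = id := by
    funext q; simp [rightTranslation_rightTranslation, rightTranslation_one]
  have h := mfderiv_comp_apply_of_eq q (hπ.mdifferentiableAt_rightTranslation g _)
    (hπ.mdifferentiableAt_rightTranslation g⁻¹ q) hq v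
  rw [e, mfderiv_id] at h
  exact h.symm

/-- The differential of a local trivialization `(π, s)` at `p`, with `s` moved to the identity by a
left translation, splits `T_p P` as `T_{π p} M × 𝔤`; the infinitesimal action is the inclusion of
the second factor. -/
lemma exists_tangentSplitting [IsManifold 𝓘(ℝ, EM) ∞ M] [LieGroup 𝓘(ℝ, EG) ∞ G]
    [IsManifold 𝓘(ℝ, EP) ∞ P] (hπ : IsPrincipalBundle EM EG EP G π) (p : P) :
    ∃ Φ : TangentSpace 𝓘(ℝ, EP) p ≃L[ℝ] (EM × EG),
      (∀ v, (Φ v).1 = mfderiv 𝓘(ℝ, EP) 𝓘(ℝ, EM) π p v) ∧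
      ∀ A, Φ (infinitesimalAction EG EP G p A) = (0, A) := by
  obtain ⟨U, T, hU, hpU, hs, ht, hT, hTs, hT1, hT2⟩ := hπ.locally_trivial (π p)
  have hp : p ∈ T.source := by rw [hs]; exact hpU
  set a : G := (T p).2 with ha
  have hTp : T p = (π p, a) := Prod.ext (hT1 p hp) rfl
  have hyt : (π p, a * 1) ∈ T.target := by rw [mul_one, ← hTp]; exact T.map_source hp
  -- Normalized so that `f p = (π p, 1)` and `f (p g) = (π p, g)`; `k` is its local inverse. They
  -- are inverse only as germs, which is enough for the differentials.
  set f : P → M × G := fun q => (π q, a⁻¹ * (T q).2) with hf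
  set k : M × G → P := fun y => T.symm (y.1, a * y.2) with hk
  have hfp : f p = (π p, 1) := by simp [hf, ← ha]
  have hkp : k (π p, 1) = p := by simp only [hk, mul_one, ← hTp]; exact T.left_inv hp
  have hTat : ContMDiffAt 𝓘(ℝ, EP) (𝓘(ℝ, EM).prod 𝓘(ℝ, EG)) ∞ T p :=
    hT.contMDiffAt (T.open_source.mem_nhds hp)
  have hTsat : ContMDiffAt (𝓘(ℝ, EM).prod 𝓘(ℝ, EG)) 𝓘(ℝ, EP) ∞ T.symm (π p, a * 1) :=
    hTs.contMDiffAt (T.open_target.mem_nhds hyt)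
  have hfd : MDifferentiableAt 𝓘(ℝ, EP) (𝓘(ℝ, EM).prod 𝓘(ℝ, EG)) f p := by
    refine ContMDiffAt.mdifferentiableAt (n := ∞) ?_ (by simp)
    exact hπ.contMDiff_proj.contMDiffAt.prodMk
      (contMDiffAt_const.mul (contMDiff_snd.contMDiffAt.comp p hTat))
  have hlift : ContMDiff (𝓘(ℝ, EM).prod 𝓘(ℝ, EG)) (𝓘(ℝ, EM).prod 𝓘(ℝ, EG)) ∞
      (fun y : M × G => (y.1, a * y.2)) :=
    contMDiff_fst.prodMk (contMDiff_const.mul contMDiff_snd)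
  have hkd : MDifferentiableAt (𝓘(ℝ, EM).prod 𝓘(ℝ, EG)) 𝓘(ℝ, EP) k (π p, 1) :=
    (ContMDiffAt.comp (π p, (1 : G)) hTsat hlift.contMDiffAt).mdifferentiableAt (by simp)
  have hkf : k ∘ f =ᶠ[nhds p] id := by
    filter_upwards [T.open_source.mem_nhds hp] with q hq
    simp only [Function.comp_apply, hf, hk, mul_inv_cancel_left, id]
    rw [← hT1 q hq]
    exact T.left_inv hq
  have hfk : f ∘ k =ᶠ[nhds (π p, 1)] id := by
    have hc : ContinuousAt (fun y : M × G => (y.1, a * y.2)) (π p, 1) :=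
      hlift.continuous.continuousAt
    filter_upwards [hc.preimage_mem_nhds (T.open_target.mem_nhds hyt)] with y hy
    have hy' : (y.1, a * y.2) ∈ T.target := hy
    have h1 := T.right_inv hy'
    have h2 := hT1 _ (T.map_target hy')
    simp only [Function.comp_apply, hf, hk, id, h1, ← h2, inv_mul_cancel_left]
  have e1 (v : TangentSpace 𝓘(ℝ, EP) p) : mfderiv (𝓘(ℝ, EM).prod 𝓘(ℝ, EG)) 𝓘(ℝ, EP) k (π p, 1)
      (mfderiv 𝓘(ℝ, EP) (𝓘(ℝ, EM).prod 𝓘(ℝ, EG)) f p v) = v := by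
    have h := mfderiv_comp_apply_of_eq p hkd hfd hfp v
    rw [hkf.mfderiv_eq, mfderiv_id] at h
    exact h.symm
  have e2 (w : EM × EG) : mfderiv 𝓘(ℝ, EP) (𝓘(ℝ, EM).prod 𝓘(ℝ, EG)) f p
      (mfderiv (𝓘(ℝ, EM).prod 𝓘(ℝ, EG)) 𝓘(ℝ, EP) k (π p, 1) w) = w := by
    have h := mfderiv_comp_apply_of_eq (π p, 1) hfd hkd hkp w
    rw [hfk.mfderiv_eq, mfderiv_id] at h
    exact h.symm
  refine ⟨ContinuousLinearEquiv.equivOfInverse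
    (mfderiv 𝓘(ℝ, EP) (𝓘(ℝ, EM).prod 𝓘(ℝ, EG)) f p)
    (mfderiv (𝓘(ℝ, EM).prod 𝓘(ℝ, EG)) 𝓘(ℝ, EP) k (π p, 1)) e1 e2, fun v => ?_, fun A => ?_⟩
  · have h := mfderiv_comp_apply (I'' := 𝓘(ℝ, EM)) p (mdifferentiableAt_fst (x := f p)) hfd v
    rw [mfderiv_fst] at h
    exact h.symm
  · have e : f ∘ (fun g : G => rightTranslation g p) = fun g => (π p, g) := by
      funext g
      simp [hf, hπ.proj_rightTranslation, hT2 p hp, ← ha]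
    have h := mfderiv_comp_apply_of_eq 1 hfd (hπ.mdifferentiableAt_orbit p 1)
      (rightTranslation_one p) A
    rw [e, mfderiv_prod_right] at h
    exact h.symm

end IsPrincipalBundle
end Bundle

/-! ### Smoothness of fundamental fields and description of the vertical space -/

section Bundle

variable {EM EG EP : Type*} [NormedAddCommGroup EM] [NormedSpace ℝ EM]
  [NormedAddCommGroup EG] [NormedSpace ℝ EG] [NormedAddCommGroup EP] [NormedSpace ℝ EP]
  {M G P : Type*} [TopologicalSpace M] [ChartedSpace EM M]
  [TopologicalSpace G] [ChartedSpace EG G] [Group G]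
  [TopologicalSpace P] [ChartedSpace EP P] [MulAction Gᵐᵒᵖ P]

namespace IsPrincipalBundle

variable {π : P → M} [LieGroup 𝓘(ℝ, EG) ∞ G] [IsManifold 𝓘(ℝ, EP) ∞ P]

/-- Fundamental vector fields are smooth. -/
lemma contMDiff_infinitesimalAction (hπ : IsPrincipalBundle EM EG EP G π)
    (A : GroupLieAlgebra 𝓘(ℝ, EG) G) :
    ContMDiff 𝓘(ℝ, EP) 𝓘(ℝ, EP).tangent ∞
      (fun q : P => (⟨q, infinitesimalAction EG EP G q A⟩ : TangentBundle 𝓘(ℝ, EP) P)) := by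
  have h0 : ContMDiff 𝓘(ℝ, EP) 𝓘(ℝ, EP).tangent ∞
      (fun q : P => (⟨q, 0⟩ : TangentBundle 𝓘(ℝ, EP) P)) := Bundle.contMDiff_zeroSection _ _
  have hA : ContMDiff 𝓘(ℝ, EP) 𝓘(ℝ, EG).tangent ∞
      (fun _ : P => (⟨1, A⟩ : TangentBundle 𝓘(ℝ, EG) G)) := contMDiff_const
  -- `A*_q` is the image of the vector `(0, A)` at `(q, 1)` under the tangent map of the action, and
  -- that vector depends smoothly on `q`.
  have h1 := (contMDiff_equivTangentBundleProd_symm (I := 𝓘(ℝ, EP)) (M := P) (I' := 𝓘(ℝ, EG))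
    (M' := G) (n := ∞)).comp (h0.prodMk hA)
  have h2 := (ContMDiff.contMDiff_tangentMap hπ.contMDiff_action (m := ∞) (by simp)).comp h1
  refine h2.congr fun q => ?_
  have e : mfderiv (𝓘(ℝ, EP).prod 𝓘(ℝ, EG)) 𝓘(ℝ, EP)
      (fun x : P × G => rightTranslation x.2 x.1) (q, 1) ((0 : EP), (A : EG)) =
      infinitesimalAction EG EP G q A := by
    have hd : MDifferentiableAt (𝓘(ℝ, EP).prod 𝓘(ℝ, EG)) 𝓘(ℝ, EP)
      (fun x : P × G => rightTranslation x.2 x.1) (q, 1) :=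
        hπ.contMDiff_action.mdifferentiableAt (by simp)
    refine (mfderiv_prod_eq_add_apply hd).trans ?_
    refine (congrArg₂ (· + ·) (map_zero _) rfl).trans (zero_add _)
  exact Bundle.TotalSpace.ext (rightTranslation_one q).symm (heq_of_eq e.symm)

variable [IsManifold 𝓘(ℝ, EM) ∞ M]

lemma infinitesimalAction_injective (hπ : IsPrincipalBundle EM EG EP G π) (p : P) :
    Function.Injective (infinitesimalAction EG EP G p) := by
  obtain ⟨Φ, -, hΦ⟩ := hπ.exists_tangentSplitting p
  intro A B hAB
  have h := congrArg Φ hAB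
  rw [hΦ, hΦ] at h
  exact congrArg Prod.snd h

/-- In the splitting `T_{π p} M × 𝔤`, `dπ` is the first projection and its kernel is the factor `𝔤`.
-/
lemma mem_vertical_iff (hπ : IsPrincipalBundle EM EG EP G π) {p : P}
    {v : TangentSpace 𝓘(ℝ, EP) p} :
    v ∈ vertical EM EP π p ↔ ∃ A, infinitesimalAction EG EP G p A = v := by
  refine ⟨fun hv => ?_, ?_⟩
  · obtain ⟨Φ, hΦ1, hΦ⟩ := hπ.exists_tangentSplitting p
    refine ⟨(Φ v).2, Φ.injective ?_⟩
    exact (hΦ _).trans (Prod.ext ((hΦ1 v).trans hv).symm rfl)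
  · rintro ⟨A, rfl⟩
    exact hπ.proj_infinitesimalAction p A

lemma finrank_eq [FiniteDimensional ℝ EM] [FiniteDimensional ℝ EG]
    (hπ : IsPrincipalBundle EM EG EP G π) (p : P) :
    Module.finrank ℝ EP = Module.finrank ℝ EM + Module.finrank ℝ EG := by
  obtain ⟨Φ, -, -⟩ := hπ.exists_tangentSplitting p
  exact (LinearEquiv.finrank_eq Φ.toLinearEquiv).trans (Module.finrank_prod ..)

end IsPrincipalBundle
end Bundle

/-! ### Smooth vector fields and one-forms on a manifold -/

section VectorFields

variable {EP : Type*} [NormedAddCommGroup EP] [NormedSpace ℝ EP]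
  {P : Type*} [TopologicalSpace P] [ChartedSpace EP P] [IsManifold 𝓘(ℝ, EP) ∞ P]

/-- Pointwise linear independence of smooth vector fields is an open condition. -/
lemma eventually_linearIndependent {ι : Type*} [Finite ι]
    {X : ι → (q : P) → TangentSpace 𝓘(ℝ, EP) q} {p : P}
    (hX : ∀ i, ContMDiffAt 𝓘(ℝ, EP) 𝓘(ℝ, EP).tangent ∞
      (fun q : P => (⟨q, X i q⟩ : TangentBundle 𝓘(ℝ, EP) P)) p)
    (hp : LinearIndependent ℝ (fun i => X i p)) :
    ∀ᶠ q in nhds p, LinearIndependent ℝ (fun i => X i q) := by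
  let e := trivializationAt EP (TangentSpace 𝓘(ℝ, EP)) p
  have hpe : p ∈ e.baseSet := FiberBundle.mem_baseSet_trivializationAt' p
  have hc : ContinuousAt (fun q i => e.continuousLinearMapAt ℝ q (X i q)) p := by
    refine continuousAt_pi.2 fun i => ?_
    refine ((Bundle.contMDiffAt_section (n := ∞) p).1 (hX i)).continuousAt.congr ?_
    filter_upwards [e.open_baseSet.mem_nhds hpe] with q hq
    simp [e, Bundle.Trivialization.coe_linearMapAt_of_mem _ hq]
  have hp' : LinearIndependent ℝ (fun i => e.continuousLinearMapAt ℝ p (X i p)) := by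
    refine hp.map' (e.continuousLinearMapAt ℝ p).toLinearMap (LinearMap.ker_eq_bot.2 ?_)
    have := (e.continuousLinearEquivAt ℝ p hpe).injective
    rwa [Bundle.Trivialization.coe_continuousLinearEquivAt_eq] at this
  filter_upwards [hc.eventually hp'.eventually] with q hq
  -- Independence of the images under a linear map implies that of the vectors, so injectivity of
  -- the trivialization is needed only at `p`.
  exact LinearIndependent.of_comp (e.continuousLinearMapAt ℝ q).toLinearMap hq

/-- Evaluating a smooth one-form on a smooth vector field gives a smooth function. -/
lemma IsSmoothOneForm.contMDiffOn_apply {EG : Type*} [NormedAddCommGroup EG] [NormedSpace ℝ EG]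
    {G : Type*} [TopologicalSpace G] [ChartedSpace EG G] [Group G]
    {θ : (p : P) → TangentSpace 𝓘(ℝ, EP) p →L[ℝ] GroupLieAlgebra 𝓘(ℝ, EG) G}
    (hθ : IsSmoothOneForm EG EP θ) {s : Set P} {X : (q : P) → TangentSpace 𝓘(ℝ, EP) q}
    (hX : ContMDiffOn 𝓘(ℝ, EP) 𝓘(ℝ, EP).tangent ∞
      (fun q : P => (⟨q, X q⟩ : TangentBundle 𝓘(ℝ, EP) P)) s) :
    ContMDiffOn (M' := EG) 𝓘(ℝ, EP) 𝓘(ℝ, EG) ∞ (fun q => θ q (X q)) s := by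
  intro x hx
  have hθ' : ContMDiff 𝓘(ℝ, EP) (𝓘(ℝ, EP).prod 𝓘(ℝ, EP →L[ℝ] EG)) ∞
    (fun p : P => Bundle.TotalSpace.mk' (EP →L[ℝ] EG)
      (E := fun q : P => TangentSpace 𝓘(ℝ, EP) q →L[ℝ] Bundle.Trivial P EG q) p (θ p)) := hθ
  have h := ContMDiffOn.clm_bundle_apply (E₂ := Bundle.Trivial P EG) (F₂ := EG)
    (b := fun q => q) hθ'.contMDiffOn hX x hx
  exact Bundle.contMDiffWithinAt_section.1 h

end VectorFields

/-! ### From a form to a smooth distribution -/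

section Bundle

variable {EM EG EP : Type*} [NormedAddCommGroup EM] [NormedSpace ℝ EM]
  [NormedAddCommGroup EG] [NormedSpace ℝ EG] [NormedAddCommGroup EP] [NormedSpace ℝ EP]
  [FiniteDimensional ℝ EG]
  {M G P : Type*} [TopologicalSpace M] [ChartedSpace EM M]
  [TopologicalSpace G] [ChartedSpace EG G] [Group G] [LieGroup 𝓘(ℝ, EG) ∞ G]
  [TopologicalSpace P] [ChartedSpace EP P] [IsManifold 𝓘(ℝ, EP) ∞ P] [MulAction Gᵐᵒᵖ P]
  {π : P → M}

namespace IsPrincipalBundle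

/-- By linearity in `A`, expanding `f` in a basis of `𝔤` gives a finite sum of smooth functions
times fundamental fields. -/
lemma contMDiffOn_infinitesimalAction (hπ : IsPrincipalBundle EM EG EP G π) {s : Set P}
    {f : P → EG} (hf : ContMDiffOn 𝓘(ℝ, EP) 𝓘(ℝ, EG) ∞ f s) :
    ContMDiffOn 𝓘(ℝ, EP) 𝓘(ℝ, EP).tangent ∞
      (fun q : P => (⟨q, infinitesimalAction EG EP G q (f q)⟩ : TangentBundle 𝓘(ℝ, EP) P)) s := by
  let b := Module.finBasis ℝ EG
  have h := ContMDiffOn.sum_section (I := 𝓘(ℝ, EP)) (n := ∞) (F := EP)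
    (V := TangentSpace 𝓘(ℝ, EP)) (u := s) (s := Finset.univ)
    (t := fun j q => LinearMap.toContinuousLinearMap (b.coord j) (f q) •
      infinitesimalAction EG EP G q (b j)) fun j _ =>
    ContMDiffOn.smul_section
      ((LinearMap.toContinuousLinearMap (b.coord j)).contMDiff.comp_contMDiffOn hf)
      (hπ.contMDiff_infinitesimalAction (b j)).contMDiffOn
  refine h.congr fun q _ => ?_
  refine congrArg (Bundle.TotalSpace.mk q) ?_
  have e := congrArg (infinitesimalAction EG EP G q) (b.sum_repr (f q)).symm
  refine e.trans ((map_sum (infinitesimalAction EG EP G q) _ _).trans ?_)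
  refine Finset.sum_congr rfl fun j _ => ?_
  exact map_smul (infinitesimalAction EG EP G q) _ _

/-- The kernels of a smooth one-form reproducing the fundamental fields form a smooth
distribution. -/
lemma isSmoothDistribution_kernelField [FiniteDimensional ℝ EM] [FiniteDimensional ℝ EP]
    [IsManifold 𝓘(ℝ, EM) ∞ M] (hπ : IsPrincipalBundle EM EG EP G π)
    {θ : (p : P) → TangentSpace 𝓘(ℝ, EP) p →L[ℝ] GroupLieAlgebra 𝓘(ℝ, EG) G}
    (hθ : IsSmoothOneForm EG EP θ) (hθL : ∀ p A, θ p (infinitesimalAction EG EP G p A) = A) :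
    IsSmoothDistribution EP (Module.finrank ℝ EM) (kernelField EG EP θ) := by
  have hfin (q : P) : FiniteDimensional ℝ (TangentSpace 𝓘(ℝ, EP) q) :=
    inferInstanceAs (FiniteDimensional ℝ EP)
  -- Rank-nullity: `θ q` is onto, with right inverse `A ↦ A*_q`.
  have hrank (q : P) : Module.finrank ℝ (kernelField EG EP θ q) = Module.finrank ℝ EM := by
    have h1 := LinearMap.finrank_range_add_finrank_ker (θ q).toLinearMap
    rw [LinearMap.range_eq_top.2 fun A => ⟨_, hθL q A⟩, finrank_top] at h1
    have h2 : Module.finrank ℝ EG + Module.finrank ℝ (kernelField EG EP θ q) =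
      Module.finrank ℝ EP := h1
    have h3 := hπ.finrank_eq q
    omega
  intro p
  let w := Module.finBasisOfFinrankEq ℝ _ (hrank p)
  let E (i : Fin (Module.finrank ℝ EM)) : (q : P) → TangentSpace 𝓘(ℝ, EP) q :=
    FiberBundle.extend EP (w i : TangentSpace 𝓘(ℝ, EP) p)
  have hE i : ∃ s ∈ nhds p, ContMDiffOn 𝓘(ℝ, EP) 𝓘(ℝ, EP).tangent ∞
      (fun q : P => (⟨q, E i q⟩ : TangentBundle 𝓘(ℝ, EP) P)) s :=
    FiberBundle.exists_contMDiffOn_extend 𝓘(ℝ, EP) EP (w i : TangentSpace 𝓘(ℝ, EP) p)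
  choose s hs hEs using hE
  -- A basis of `ker θ_p` is extended to arbitrary local fields `E i`, which are then projected onto
  -- the kernels along the vertical spaces. The projection leaves the values at `p` unchanged, so
  -- independence persists nearby.
  let X (i : Fin (Module.finrank ℝ EM)) (q : P) : TangentSpace 𝓘(ℝ, EP) q :=
    E i q - infinitesimalAction EG EP G q (θ q (E i q))
  have hX i : ContMDiffOn 𝓘(ℝ, EP) 𝓘(ℝ, EP).tangent ∞
      (fun q : P => (⟨q, X i q⟩ : TangentBundle 𝓘(ℝ, EP) P)) (s i) :=
    ContMDiffOn.sub_section (hEs i)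
      (hπ.contMDiffOn_infinitesimalAction (hθ.contMDiffOn_apply (hEs i)))
  have hXp i : X i p = w i := by
    have h1 : E i p = w i := FiberBundle.extend_apply_self ..
    have h2 : θ p (w i) = 0 := (w i).2
    simp [X, h1, h2]
  have hXker i q : X i q ∈ kernelField EG EP θ q := by
    change θ q (E i q - infinitesimalAction EG EP G q (θ q (E i q))) = 0
    rw [map_sub, hθL, sub_self]
  have hlin : ∀ᶠ q in nhds p, LinearIndependent ℝ (fun i => X i q) := by
    refine eventually_linearIndependent (fun i => (hX i).contMDiffAt (hs i)) ?_
    simp only [hXp]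
    exact w.linearIndependent.map' (Submodule.subtype _) (Submodule.ker_subtype _)
  obtain ⟨U, hU, hUo, hpU⟩ := mem_nhds_iff.1 (Filter.inter_mem (Filter.iInter_mem.2 hs) hlin)
  refine ⟨U, X, hUo, hpU, fun i => (hX i).mono fun q hq => Set.mem_iInter.1 (hU hq).1 i,
    fun q hq => ⟨(hU hq).2, ?_⟩⟩
  refine Submodule.eq_of_le_of_finrank_eq (Submodule.span_le.2 ?_) ?_
  · rintro _ ⟨i, rfl⟩
    exact hXker i q
  · rw [hrank, finrank_span_eq_card (hU hq).2, Fintype.card_fin]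

end IsPrincipalBundle
end Bundle

/-- A field of linear forms is smooth at `p` if its values on a smooth frame near `p` are. -/
lemma contMDiffAt_oneForm_of_frame {EP : Type*} [NormedAddCommGroup EP] [NormedSpace ℝ EP]
    [FiniteDimensional ℝ EP] {P : Type*} [TopologicalSpace P] [ChartedSpace EP P]
    [IsManifold 𝓘(ℝ, EP) ∞ P] {EG : Type*} [NormedAddCommGroup EG] [NormedSpace ℝ EG]
    {ι : Type*} [Fintype ι] (hι : Fintype.card ι = Module.finrank ℝ EP)
    {θ : (p : P) → TangentSpace 𝓘(ℝ, EP) p →L[ℝ] EG}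
    {Y : ι → (q : P) → TangentSpace 𝓘(ℝ, EP) q} {p : P}
    (hY : ∀ i, ContMDiffAt 𝓘(ℝ, EP) 𝓘(ℝ, EP).tangent ∞
      (fun q : P => (⟨q, Y i q⟩ : TangentBundle 𝓘(ℝ, EP) P)) p)
    (hp : LinearIndependent ℝ (fun i => Y i p))
    (hθ : ∀ i, ContMDiffAt 𝓘(ℝ, EP) 𝓘(ℝ, EG) ∞ (fun q => θ q (Y i q)) p) :
    ContMDiffAt 𝓘(ℝ, EP) (𝓘(ℝ, EP).prod 𝓘(ℝ, EP →L[ℝ] EG)) ∞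
      (fun p : P => Bundle.TotalSpace.mk' (EP →L[ℝ] EG)
        (E := fun q : P => TangentSpace 𝓘(ℝ, EP) q →L[ℝ] Bundle.Trivial P EG q) p (θ p)) p := by
  let e := trivializationAt EP (TangentSpace 𝓘(ℝ, EP)) p
  have hpe : p ∈ e.baseSet := FiberBundle.mem_baseSet_trivializationAt' p
  let y (i : ι) (q : P) : EP := e.continuousLinearMapAt ℝ q (Y i q)
  have hy i : ContMDiffAt 𝓘(ℝ, EP) 𝓘(ℝ, EP) ∞ (y i) p := by
    refine ((Bundle.contMDiffAt_section (n := ∞) p).1 (hY i)).congr_of_eventuallyEq ?_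
    filter_upwards [e.open_baseSet.mem_nhds hpe] with q hq
    simp [y, e, Bundle.Trivialization.coe_linearMapAt_of_mem _ hq]
  -- `B q` sends coefficients to the combination of the frame, read in the trivialization, and `C q`
  -- sends them to the value of `θ` on it. Hence `θ` reads as `C ∘ B⁻¹` near `p`, and inversion is
  -- smooth at invertible maps.
  let B (q : P) : (ι → ℝ) →L[ℝ] EP := ∑ i, (ContinuousLinearMap.proj i).smulRight (y i q)
  let C (q : P) : (ι → ℝ) →L[ℝ] EG := ∑ i, (ContinuousLinearMap.proj i).smulRight (θ q (Y i q))
  have hB : ContMDiffAt 𝓘(ℝ, EP) 𝓘(ℝ, (ι → ℝ) →L[ℝ] EP) ∞ B p :=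
    contMDiffAt_finsetSum fun i _ =>
      ((ContinuousLinearMap.smulRightL ℝ (ι → ℝ) EP
        (ContinuousLinearMap.proj i)).contMDiff.contMDiffAt).comp p (hy i)
  have hC : ContMDiffAt 𝓘(ℝ, EP) 𝓘(ℝ, (ι → ℝ) →L[ℝ] EG) ∞ C p :=
    contMDiffAt_finsetSum fun i _ =>
      ((ContinuousLinearMap.smulRightL ℝ (ι → ℝ) EG
        (ContinuousLinearMap.proj i)).contMDiff.contMDiffAt).comp p (hθ i)
  have hBapply q (c : ι → ℝ) : B q c = e.continuousLinearMapAt ℝ q (∑ i, c i • Y i q) := by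
    simp [B, y, map_sum]
  have hCapply q (c : ι → ℝ) : C q c = θ q (∑ i, c i • Y i q) := by
    simp [C, map_sum]
  have hinv q (hq : q ∈ e.baseSet) (hlin : LinearIndependent ℝ (fun i => Y i q)) :
      (B q).IsInvertible := by
    have hinj : Function.Injective (B q) := by
      refine (injective_iff_map_eq_zero (B q)).2 fun c hc => ?_
      rw [hBapply] at hc
      have h0 := (e.continuousLinearEquivAt ℝ q hq).injective
      rw [Bundle.Trivialization.coe_continuousLinearEquivAt_eq] at h0
      exact funext (Fintype.linearIndependent_iff.1 hlin c (h0 (hc.trans (map_zero _).symm)))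
    exact ⟨(LinearEquiv.ofInjectiveOfFinrankEq (B q).toLinearMap hinj
      (by simp [hι])).toContinuousLinearEquiv, by ext; rfl⟩
  have hBinv : ContMDiffAt 𝓘(ℝ, EP) 𝓘(ℝ, EP →L[ℝ] (ι → ℝ)) ∞
      (fun q => ContinuousLinearMap.inverse (B q)) p :=
    (hinv p hpe hp).contDiffAt_map_inverse.contMDiffAt.comp p hB
  refine (contMDiffAt_hom_bundle _).2 ⟨contMDiffAt_id, ?_⟩
  refine (hC.clm_comp hBinv).congr_of_eventuallyEq ?_
  filter_upwards [e.open_baseSet.mem_nhds hpe, eventually_linearIndependent hY hp] with q hq hlin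
  obtain ⟨N, hN⟩ := hinv q hq hlin
  ext u
  obtain ⟨c, rfl⟩ := N.surjective u
  have h1 : N c = e.continuousLinearMapAt ℝ q (∑ i, c i • Y i q) := by
    rw [← hBapply, ← hN]; rfl
  have h2 : e.symmL ℝ q (N c) = ∑ i, c i • Y i q := by
    rw [h1]; exact e.symmL_continuousLinearMapAt hq _
  have h3 : C q (ContinuousLinearMap.inverse (B q) (N c)) = θ q (∑ i, c i • Y i q) := by
    rw [← hN, ContinuousLinearMap.inverse_equiv, ← hCapply]
    simp
  simp only [ContinuousLinearMap.inCoordinates, Bundle.Trivial.fiberBundle_trivializationAt',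
    Bundle.Trivial.continuousLinearMapAt_trivialization, ContinuousLinearMap.id_comp,
    ContinuousLinearMap.comp_apply]
  exact (congrArg (θ q) h2).trans h3.symm

/-! ### The correspondence between connection forms and horizontal distributions -/

section Bundle

variable {EM EG EP : Type*} [NormedAddCommGroup EM] [NormedSpace ℝ EM]
  [NormedAddCommGroup EG] [NormedSpace ℝ EG] [NormedAddCommGroup EP] [NormedSpace ℝ EP]
  {M G P : Type*} [TopologicalSpace M] [ChartedSpace EM M]
  [TopologicalSpace G] [ChartedSpace EG G] [Group G] [LieGroup 𝓘(ℝ, EG) ∞ G]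
  [TopologicalSpace P] [ChartedSpace EP P] [IsManifold 𝓘(ℝ, EP) ∞ P] [MulAction Gᵐᵒᵖ P]
  {π : P → M} {θ : (p : P) → TangentSpace 𝓘(ℝ, EP) p →L[ℝ] GroupLieAlgebra 𝓘(ℝ, EG) G}
  {H : (p : P) → Submodule ℝ (TangentSpace 𝓘(ℝ, EP) p)}

namespace IsConnectionForm

variable [FiniteDimensional ℝ EG] [T2Space G]

lemma apply_infinitesimalAction (hπ : IsPrincipalBundle EM EG EP G π)
    (hθ : IsConnectionForm EG EP θ) (p : P) (A : GroupLieAlgebra 𝓘(ℝ, EG) G) :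
    θ p (infinitesimalAction EG EP G p A) = A := by
  rw [← hπ.fundamentalField_eq]
  exact hθ.fundamental A p

lemma isHorizontalDistribution_kernelField [FiniteDimensional ℝ EM] [FiniteDimensional ℝ EP]
    [IsManifold 𝓘(ℝ, EM) ∞ M] (hπ : IsPrincipalBundle EM EG EP G π)
    (hθ : IsConnectionForm EG EP θ) :
    IsHorizontalDistribution EM EP G π (kernelField EG EP θ) where
  isCompl p := by
    have hL := hθ.apply_infinitesimalAction hπ p
    refine IsCompl.of_eq ?_ ?_
    · refine (Submodule.eq_bot_iff _).2 fun v hv => ?_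
      obtain ⟨A, rfl⟩ := hπ.mem_vertical_iff.1 hv.1
      have hA : A = 0 := (hL A).symm.trans hv.2
      rw [hA, map_zero]
    · refine (Submodule.eq_top_iff').2 fun v => ?_
      refine Submodule.mem_sup.2 ⟨infinitesimalAction EG EP G p (θ p v),
        hπ.mem_vertical_iff.2 ⟨_, rfl⟩, v - infinitesimalAction EG EP G p (θ p v), ?_,
        add_sub_cancel _ _⟩
      change θ p (v - infinitesimalAction EG EP G p (θ p v)) = 0
      rw [map_sub, hL, sub_self]
  smooth := hπ.isSmoothDistribution_kernelField hθ.smooth (hθ.apply_infinitesimalAction hπ)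
  equivariant g p := by
    have hle (g : G) (p : P) (v : TangentSpace 𝓘(ℝ, EP) p) (hv : θ p v = 0) :
        θ (rightTranslation g p)
          (mfderiv 𝓘(ℝ, EP) 𝓘(ℝ, EP) (rightTranslation g) p v) = 0 := by
      rw [hθ.equivariant, hv, map_zero]
    have hp : rightTranslation g⁻¹ (rightTranslation g p) = p := by
      simp [rightTranslation_rightTranslation, rightTranslation_one]
    -- For the reverse inclusion, a vector of the kernel at `p g` is pulled back by `R_{g⁻¹}`, which
    -- also preserves kernels.
    refine le_antisymm (Submodule.map_le_iff_le_comap.2 fun v hv => hle g p v hv) fun v hv =>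
      ⟨mfderiv 𝓘(ℝ, EP) 𝓘(ℝ, EP) (rightTranslation g⁻¹) (rightTranslation g p) v, ?_,
        hπ.mfderiv_rightTranslation_inv hp v⟩
    have h := hle g⁻¹ (rightTranslation g p) v hv
    -- The base point `(p g) g⁻¹` equals `p` only propositionally; viewing the vector in the model
    -- space `EP` allows the transport.
    have hcast (p' : P) (w : EP) (hp' : p' = p) (hw : θ p' w = 0) : θ p w = 0 := hp' ▸ hw
    exact hcast _ _ hp h

/-- A connection form is determined by its kernels. -/
lemma eq_of_kernelField_eq (hπ : IsPrincipalBundle EM EG EP G π) (hθ : IsConnectionForm EG EP θ)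
    {θ' : (p : P) → TangentSpace 𝓘(ℝ, EP) p →L[ℝ] GroupLieAlgebra 𝓘(ℝ, EG) G}
    (hθ' : IsConnectionForm EG EP θ') (h : kernelField EG EP θ = kernelField EG EP θ') :
    θ = θ' := by
  funext p
  refine ContinuousLinearMap.ext fun v => ?_
  have h1 : v - infinitesimalAction EG EP G p (θ p v) ∈ kernelField EG EP θ p := by
    change θ p (v - infinitesimalAction EG EP G p (θ p v)) = 0
    rw [map_sub, hθ.apply_infinitesimalAction hπ, sub_self]
  rw [h] at h1
  have h2 : θ' p (v - infinitesimalAction EG EP G p (θ p v)) = 0 := h1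
  rw [map_sub, hθ'.apply_infinitesimalAction hπ, sub_eq_zero] at h2
  exact h2.symm

end IsConnectionForm

namespace IsHorizontalDistribution

variable [FiniteDimensional ℝ EP] [IsManifold 𝓘(ℝ, EM) ∞ M]

/-- The projection along `H_p` onto the vertical subspace, read in the Lie algebra. -/
lemma exists_form (hπ : IsPrincipalBundle EM EG EP G π)
    (hH : IsHorizontalDistribution EM EP G π H) (p : P) :
    ∃ φ : TangentSpace 𝓘(ℝ, EP) p →L[ℝ] GroupLieAlgebra 𝓘(ℝ, EG) G,
      (∀ A, φ (infinitesimalAction EG EP G p A) = A) ∧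
      LinearMap.ker φ.toLinearMap = H p := by
  have hfin : FiniteDimensional ℝ (TangentSpace 𝓘(ℝ, EP) p) :=
    inferInstanceAs (FiniteDimensional ℝ EP)
  have ht2 : T2Space (TangentSpace 𝓘(ℝ, EP) p) := inferInstanceAs (T2Space EP)
  have hr : LinearMap.range (infinitesimalAction EG EP G p).toLinearMap = vertical EM EP π p :=
    Submodule.ext fun v => hπ.mem_vertical_iff.symm
  have hc : IsCompl (LinearMap.range (infinitesimalAction EG EP G p).toLinearMap) (H p) := by
    rw [hr]; exact hH.isCompl p
  refine ⟨LinearMap.toContinuousLinearMap (LinearMap.linearProjOfIsCompl (H p)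
    (infinitesimalAction EG EP G p).toLinearMap (hπ.infinitesimalAction_injective p) hc),
    fun A => ?_, ?_⟩
  · exact LinearMap.linearProjOfIsCompl_apply_left _ _ (hπ.infinitesimalAction_injective p) hc A
  · exact LinearMap.ker_linearProjOfIsCompl _ _ (hπ.infinitesimalAction_injective p) hc

lemma isSmoothOneForm [FiniteDimensional ℝ EM] [FiniteDimensional ℝ EG]
    (hπ : IsPrincipalBundle EM EG EP G π)
    (hH : IsHorizontalDistribution EM EP G π H)
    (hθL : ∀ p A, θ p (infinitesimalAction EG EP G p A) = A)
    (hθH : ∀ p, LinearMap.ker (θ p).toLinearMap = H p) :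
    IsSmoothOneForm EG EP θ := by
  intro p
  obtain ⟨U, X, hU, hpU, hX, hspan⟩ := hH.smooth p
  let b := Module.finBasis ℝ EG
  have hXθ i q (hq : q ∈ U) : θ q (X i q) = 0 := by
    have : X i q ∈ H q := (hspan q hq).2 ▸ Submodule.subset_span ⟨i, rfl⟩
    rw [← hθH] at this
    exact this
  -- The frame joins a local frame of `H` to the fundamental fields of a basis `b` of `𝔤`; `θ` is
  -- `0` on the former and the constant `b j` on the latter.
  refine contMDiffAt_oneForm_of_frame (EG := EG)
    (ι := Fin (Module.finrank ℝ EM) ⊕ Fin (Module.finrank ℝ EG))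
    (Y := Sum.elim X fun j q => infinitesimalAction EG EP G q (b j)) ?_ ?_ ?_ ?_
  · simp [hπ.finrank_eq p]
  · rintro (i | j)
    · exact (hX i).contMDiffAt (hU.mem_nhds hpU)
    · exact (hπ.contMDiff_infinitesimalAction (b j)).contMDiffAt
  · have hb : LinearIndependent ℝ (fun j => infinitesimalAction EG EP G p (b j)) :=
      b.linearIndependent.map' (infinitesimalAction EG EP G p).toLinearMap
        (LinearMap.ker_eq_bot.2 (hπ.infinitesimalAction_injective p))
    have h := (hspan p hpU).1.sum_type hb (by
      refine Submodule.disjoint_def.2 fun v hv hv' => ?_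
      rw [(hspan p hpU).2] at hv
      refine (Submodule.disjoint_def.1 (hH.isCompl p).disjoint) v ?_ hv
      refine Submodule.span_le.2 ?_ hv'
      rintro _ ⟨j, rfl⟩
      exact hπ.mem_vertical_iff.2 ⟨_, rfl⟩)
    have e : (fun i => Sum.elim X (fun j q => infinitesimalAction EG EP G q (b j)) i p) =
        Sum.elim (fun i => X i p) fun j => infinitesimalAction EG EP G p (b j) := by
      funext i
      cases i <;> rfl
    exact e ▸ h
  · rintro (i | j)
    · refine (contMDiffAt_const (c := (0 : EG))).congr_of_eventuallyEq ?_
      filter_upwards [hU.mem_nhds hpU] with q hq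
      exact hXθ i q hq
    · refine (contMDiffAt_const (c := b j)).congr_of_eventuallyEq ?_
      exact Filter.Eventually.of_forall fun q => hθL q (b j)

lemma exists_isConnectionForm [FiniteDimensional ℝ EM] [FiniteDimensional ℝ EG] [T2Space G]
    (hπ : IsPrincipalBundle EM EG EP G π)
    (hH : IsHorizontalDistribution EM EP G π H) :
    ∃ θ : (p : P) → TangentSpace 𝓘(ℝ, EP) p →L[ℝ] GroupLieAlgebra 𝓘(ℝ, EG) G,
      IsConnectionForm EG EP θ ∧ kernelField EG EP θ = H := by
  choose θ hθL hθH using hH.exists_form hπ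
  refine ⟨θ, ⟨hH.isSmoothOneForm hπ hθL hθH, fun A p => ?_, fun g p v => ?_⟩, funext hθH⟩
  · rw [hπ.fundamentalField_eq]
    exact hθL p A
  -- The horizontal part of `v` stays horizontal under `R_g`, hence is killed by `θ`; the vertical
  -- part `(θ v)*` is sent to `(Ad_{g⁻¹} θ v)*`, which gives the value.
  · have hv : v - infinitesimalAction EG EP G p (θ p v) ∈ H p := by
      rw [← hθH]
      change θ p (v - infinitesimalAction EG EP G p (θ p v)) = 0
      rw [map_sub, hθL, sub_self]
    have hgv : mfderiv 𝓘(ℝ, EP) 𝓘(ℝ, EP) (rightTranslation g) p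
        (v - infinitesimalAction EG EP G p (θ p v)) ∈ H (rightTranslation g p) :=
      hH.equivariant g p ▸ Submodule.mem_map_of_mem hv
    rw [← hθH] at hgv
    have h0 : θ (rightTranslation g p) (mfderiv 𝓘(ℝ, EP) 𝓘(ℝ, EP) (rightTranslation g) p
        (v - infinitesimalAction EG EP G p (θ p v))) = 0 := hgv
    rw [map_sub, hπ.mfderiv_rightTranslation_infinitesimalAction, map_sub, hθL,
      sub_eq_zero] at h0
    exact h0

end IsHorizontalDistribution
end Bundle

end

end PrincipalConnection

theorem mainTheorem4
    (EM EG EP : Type*)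
    [NormedAddCommGroup EM] [NormedSpace ℝ EM] [FiniteDimensional ℝ EM]
    [NormedAddCommGroup EG] [NormedSpace ℝ EG] [FiniteDimensional ℝ EG]
    [NormedAddCommGroup EP] [NormedSpace ℝ EP] [FiniteDimensional ℝ EP]
    (M G P : Type*)
    [TopologicalSpace M] [T2Space M] [ChartedSpace EM M] [IsManifold 𝓘(ℝ, EM) ∞ M]
    [TopologicalSpace G] [T2Space G] [ChartedSpace EG G] [Group G] [LieGroup 𝓘(ℝ, EG) ∞ G]
    [TopologicalSpace P] [T2Space P] [ChartedSpace EP P] [IsManifold 𝓘(ℝ, EP) ∞ P]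
    [MulAction Gᵐᵒᵖ P] (π : P → M)
    (hπ : PrincipalConnection.IsPrincipalBundle EM EG EP G π) :
    Set.BijOn (PrincipalConnection.kernelField EG EP (G := G) (P := P))
      {θ | PrincipalConnection.IsConnectionForm EG EP θ}
      {H | PrincipalConnection.IsHorizontalDistribution EM EP G π H} :=
  ⟨fun _ hθ => hθ.isHorizontalDistribution_kernelField hπ,
    fun _ hθ _ hθ' h => hθ.eq_of_kernelField_eq hπ hθ' h,
    fun _ hH => hH.exists_isConnectionForm hπ⟩
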